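/- Let $(R,\mathfrak m)$ be a Noetherian local ring and let $I\subsetneq R$ be a perfect ideal, i.e. $\operatorname{projdim}_R(R/I)=\operatorname{grade}(I)$, where $\operatorname{grade}(I)$ is the supremum of the lengths of $R$-regular sequences contained in $I$. Let $\nu(I)$ be the minimal number of generators of $I$, and suppose that $\nu(I)=\operatorname{grade}(I)+2$. Let $\mathbf y=(y_1,\dots,y_l)$, $l=\nu(I)$, be any minimal system of generators of $I$, and let $H_1(I)=H_1(\mathbf y,R)$ be the first homology module of the Koszul complex $\mathbb K_\bullet(\mathbf y,R)$. Then $\operatorname{projdim}_R H_1(I)<\infty$. -/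

import Mathlib

open CategoryTheory

universe u

namespace Koszul

section

variable {R : Type u} [CommRing R]

/-- Contraction with a linear form `φ` lowers the exterior degree by one. -/
theorem contractLeft_mem {M : Type u} [AddCommGroup M] [Module R M] (φ : Module.Dual R M) (p : ℕ)
    (x : ExteriorAlgebra R M) (hx : x ∈ ⋀[R]^(p + 1) M) :
    CliffordAlgebra.contractLeft (Q := (0 : QuadraticForm R M)) φ x ∈ ⋀[R]^p M := by
  induction p generalizing x with
  | zero =>
    rw [ExteriorAlgebra.exteriorPower, zero_add, pow_one] at hx
    obtain ⟨m, rfl⟩ := hx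
    rw [ExteriorAlgebra.exteriorPower, pow_zero]
    exact Submodule.mem_one.2 ⟨φ m, (CliffordAlgebra.contractLeft_ι _ _ _).symm⟩
  | succ p ih =>
    rw [ExteriorAlgebra.exteriorPower, pow_succ'] at hx
    refine Submodule.mul_induction_on hx ?_ ?_
    · rintro _ ⟨m, rfl⟩ b hb
      have h : CliffordAlgebra.contractLeft (Q := (0 : QuadraticForm R M)) φ
          (ExteriorAlgebra.ι R m * b) = φ m • b - ExteriorAlgebra.ι R m *
            CliffordAlgebra.contractLeft (Q := (0 : QuadraticForm R M)) φ b :=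
        CliffordAlgebra.contractLeft_ι_mul _ _ _
      rw [h]
      refine Submodule.sub_mem _ (Submodule.smul_mem _ _ hb) ?_
      rw [ExteriorAlgebra.exteriorPower, pow_succ']
      exact Submodule.mul_mem_mul ⟨m, rfl⟩ (ih b hb)
    · intro a b ha hb
      rw [map_add]
      exact Submodule.add_mem _ ha hb

/-- The Koszul differential `⋀^(p+1) M → ⋀^p M` of a linear form `φ` on `M`:
`m₀ ∧ ⋯ ∧ m_p ↦ ∑ i, (-1)^i φ(m_i) m₀ ∧ ⋯ ∧ m̂_i ∧ ⋯ ∧ m_p`. -/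
noncomputable def differential {M : Type u} [AddCommGroup M] [Module R M]
    (φ : Module.Dual R M) (p : ℕ) : ⋀[R]^(p + 1) M →ₗ[R] ⋀[R]^p M :=
  LinearMap.restrict (CliffordAlgebra.contractLeft (Q := (0 : QuadraticForm R M)) φ)
    (contractLeft_mem φ p)

theorem differential_comp {M : Type u} [AddCommGroup M] [Module R M]
    (φ : Module.Dual R M) (p : ℕ) : differential φ p ∘ₗ differential φ (p + 1) = 0 := by
  ext1
  ext1 v
  exact Subtype.ext (CliffordAlgebra.contractLeft_contractLeft φ _)

/-- The Koszul complex `K_•(y₁, …, y_l; R)` of a sequence of elements of `R`: the exterior algebra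
of `R^l` with the differential determined by `e_i ↦ y_i`. -/
noncomputable def complex {l : ℕ} (y : Fin l → R) : ChainComplex (ModuleCat.{u} R) ℕ :=
  ChainComplex.of (fun p => ModuleCat.of R (⋀[R]^p (Fin l → R)))
    (fun p => ModuleCat.ofHom (differential (Fintype.linearCombination R y) p))
    (fun p => by rw [← ModuleCat.ofHom_comp, differential_comp]; rfl)

/-- The Koszul homology module `H_i(y₁, …, y_l; R)`. -/
noncomputable def homology {l : ℕ} (y : Fin l → R) (i : ℕ) : ModuleCat.{u} R :=
  (complex y).homology i

end

end Koszul

/-- The grade of an ideal `I`: the supremum of the lengths of the `R`-regular sequences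
contained in `I`. For a proper ideal `I`, a weakly regular sequence in `I` is regular; the unit
ideal contains the weakly regular sequences `1, …, 1`, so it has grade `⊤`. -/
noncomputable def Ideal.grade {R : Type u} [CommRing R] (I : Ideal R) : ℕ∞ :=
  ⨆ (rs : List R) (_ : (∀ r ∈ rs, r ∈ I) ∧ RingTheory.Sequence.IsWeaklyRegular R rs),
    (rs.length : ℕ∞)

/-- A proper ideal `I` is perfect if the projective dimension of `R ⧸ I` over `R` equals the grade
of `I`. -/
def Ideal.IsPerfect {R : Type u} [CommRing R] (I : Ideal R) : Prop :=
  I ≠ ⊤ ∧ projectiveDimension (ModuleCat.of R (R ⧸ I)) = ((I.grade : ℕ∞) : WithBot ℕ∞)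

/-! Let K be the Koszul complex on y, g the grade of I, C_p the cokernel of K_{p+1} → K_p, and Z_1,
B_1 the cycles and boundaries in degree 1, so H_1 = Z_1 / B_1. Z_1 is a second syzygy of R/I, hence
of finite projective dimension. B_1 is C_2 / H_2, so it remains to treat C_2 and H_2.

K has length g + 2 and is exact above degree 2, so its top part is a finite free resolution of C_2
(`LinearMap.subsingleton_ext_quotient_range`). As I kills H_2 and Hom(R/I, K_1) = 0, H_2 is Hom(R/I,
C_2). Shifting along that resolution turns this into Ext^g(R/I, K_l)
(`LinearMap.hasFiniteProjectiveDimension_ext_quotient_range`). By perfection, R/I has a projective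
resolution of length g whose dual into K_l is exact except at the end, so the dual resolves
Ext^g(R/I, K_l) (`ModuleCat.hasFiniteProjectiveDimension_ext`). -/

open Abelian Module

/-! ### Finite projective dimension in exact sequences -/

section FiniteProjectiveDimension

variable (R : Type u) [CommRing R]

/-- The module `M` has finite projective dimension over `R`. -/
def Module.HasFiniteProjectiveDimension (M : Type u) [AddCommGroup M] [Module R M] : Prop :=
  ∃ n, HasProjectiveDimensionLT (ModuleCat.of R M) n

end FiniteProjectiveDimension

namespace Module.HasFiniteProjectiveDimension

variable {R : Type u} [CommRing R]
variable {A B C D : Type u} [AddCommGroup A] [AddCommGroup B] [AddCommGroup C] [AddCommGroup D]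
  [Module R A] [Module R B] [Module R C] [Module R D]

theorem of_linearEquiv (h : HasFiniteProjectiveDimension R A) (e : A ≃ₗ[R] B) :
    HasFiniteProjectiveDimension R B :=
  let ⟨n, _⟩ := h
  ⟨n, hasProjectiveDimensionLT_of_iso e.toModuleIso n⟩

theorem of_projective [Module.Projective R A] : HasFiniteProjectiveDimension R A :=
  ⟨1, inferInstance⟩

theorem projectiveDimension_lt_top (h : HasFiniteProjectiveDimension R A) :
    projectiveDimension (ModuleCat.of R A) < ⊤ := by
  obtain ⟨n, hn⟩ := h
  rw [lt_top_iff_ne_top, projectiveDimension_ne_top_iff]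
  exact ⟨n, hasProjectiveDimensionLT_of_ge _ n _ (Nat.le_succ n)⟩

end Module.HasFiniteProjectiveDimension

/-- The short complex of modules attached to an exact pair of linear maps. -/
abbrev Function.Exact.moduleCatShortComplex {R : Type u} [CommRing R] {A B C : Type u}
    [AddCommGroup A] [AddCommGroup B] [AddCommGroup C] [Module R A] [Module R B] [Module R C]
    {f : A →ₗ[R] B} {g : B →ₗ[R] C} (h : Function.Exact f g) : ShortComplex (ModuleCat.{u} R) :=
  ModuleCat.shortComplexOfCompEqZero f g h.linearMap_comp_eq_zero

theorem Function.Exact.shortExact_moduleCatShortComplex {R : Type u} [CommRing R] {A B C : Type u}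
    [AddCommGroup A] [AddCommGroup B] [AddCommGroup C] [Module R A] [Module R B] [Module R C]
    {f : A →ₗ[R] B} {g : B →ₗ[R] C} (h : Function.Exact f g) (hf : Function.Injective f)
    (hg : Function.Surjective g) : h.moduleCatShortComplex.ShortExact :=
  ModuleCat.shortComplex_shortExact _ h hf hg

namespace Module.HasFiniteProjectiveDimension

variable {R : Type u} [CommRing R]
variable {A B C D E : Type u} [AddCommGroup A] [AddCommGroup B] [AddCommGroup C] [AddCommGroup D]
  [AddCommGroup E] [Module R A] [Module R B] [Module R C] [Module R D] [Module R E]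
  {f : A →ₗ[R] B} {g : B →ₗ[R] C}

theorem of_exact_left (h : Function.Exact f g) (hf : Function.Injective f)
    (hg : Function.Surjective g) (hB : HasFiniteProjectiveDimension R B)
    (hC : HasFiniteProjectiveDimension R C) : HasFiniteProjectiveDimension R A := by
  obtain ⟨m, hm⟩ := hB
  obtain ⟨n, hn⟩ := hC
  exact ⟨max m n, (h.shortExact_moduleCatShortComplex hf hg).hasProjectiveDimensionLT_X₁ _
    (hasProjectiveDimensionLT_of_ge _ m _ (le_max_left m n))
    (hasProjectiveDimensionLT_of_ge _ n _ ((le_max_right m n).trans (Nat.le_succ _)))⟩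

theorem of_exact_right (h : Function.Exact f g) (hf : Function.Injective f)
    (hg : Function.Surjective g) (hA : HasFiniteProjectiveDimension R A)
    (hB : HasFiniteProjectiveDimension R B) : HasFiniteProjectiveDimension R C := by
  obtain ⟨m, hm⟩ := hA
  obtain ⟨n, hn⟩ := hB
  exact ⟨max m n + 1, (h.shortExact_moduleCatShortComplex hf hg).hasProjectiveDimensionLT_X₃ _
    (hasProjectiveDimensionLT_of_ge _ m _ (le_max_left m n))
    (hasProjectiveDimensionLT_of_ge _ n _ ((le_max_right m n).trans (Nat.le_succ _)))⟩

theorem quotient {N : Submodule R A} (hN : HasFiniteProjectiveDimension R N)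
    (hA : HasFiniteProjectiveDimension R A) : HasFiniteProjectiveDimension R (A ⧸ N) :=
  of_exact_right (LinearMap.exact_subtype_mkQ N) N.subtype_injective N.mkQ_surjective hN hA

theorem range_of_ker (hA : HasFiniteProjectiveDimension R A) (f : A →ₗ[R] B)
    (hf : HasFiniteProjectiveDimension R (LinearMap.ker f)) :
    HasFiniteProjectiveDimension R (LinearMap.range f) :=
  (hf.quotient hA).of_linearEquiv f.quotKerEquivRange

theorem ker_of_range (hA : HasFiniteProjectiveDimension R A) (f : A →ₗ[R] B)
    (hf : HasFiniteProjectiveDimension R (LinearMap.range f)) :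
    HasFiniteProjectiveDimension R (LinearMap.ker f) :=
  of_exact_left (LinearMap.exact_subtype_mkQ _) (LinearMap.ker f).subtype_injective
    (Submodule.mkQ_surjective _) hA (hf.of_linearEquiv f.quotKerEquivRange.symm)

theorem of_quotient {N : Submodule R A} (hA : HasFiniteProjectiveDimension R A)
    (hN : HasFiniteProjectiveDimension R (A ⧸ N)) : HasFiniteProjectiveDimension R N :=
  of_exact_left (LinearMap.exact_subtype_mkQ N) N.subtype_injective N.mkQ_surjective hA hN

/-- In an exact sequence `0 → A → B → C → D → 0`, if `A`, `B`, `C` have finite projective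
dimension then so does `D`. -/
theorem of_exact_of_exact {h : C →ₗ[R] D} (hf : Function.Injective f) (hfg : Function.Exact f g)
    (hgh : Function.Exact g h) (hh : Function.Surjective h)
    (hA : HasFiniteProjectiveDimension R A) (hB : HasFiniteProjectiveDimension R B)
    (hC : HasFiniteProjectiveDimension R C) : HasFiniteProjectiveDimension R D := by
  have hker : HasFiniteProjectiveDimension R (LinearMap.ker g) :=
    hA.of_linearEquiv ((LinearEquiv.ofInjective f hf).trans
      (LinearEquiv.ofEq _ _ (LinearMap.exact_iff.1 hfg).symm))
  have hrange : HasFiniteProjectiveDimension R (LinearMap.ker h) :=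
    (hB.range_of_ker g hker).of_linearEquiv (LinearEquiv.ofEq _ _ (LinearMap.exact_iff.1 hgh).symm)
  exact (hrange.quotient hC).of_linearEquiv (h.quotKerEquivOfSurjective hh)

end Module.HasFiniteProjectiveDimension

/-! ### Ext into finite free modules -/

section Ext

variable {R : Type u} [CommRing R]

theorem Module.Projective.linearMap_of_finite {M F : Type u} [AddCommGroup M] [Module R M]
    [AddCommGroup F] [Module R F] [Module.Finite R M] [Module.Projective R M]
    [Module.Finite R F] [Module.Free R F] : Module.Projective R (M →ₗ[R] F) := by
  obtain ⟨n, f, hf⟩ := Module.Finite.exists_fin' R M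
  obtain ⟨s, hs⟩ := Module.projective_lifting_property f LinearMap.id hf
  refine Module.Projective.of_split (LinearMap.lcomp R F f) (LinearMap.lcomp R F s) ?_
  ext φ x
  exact congrArg φ (LinearMap.congr_fun hs x)

theorem ModuleCat.projective_ext_zero (M F : ModuleCat.{u} R) [Module.Finite R M]
    [Module.Projective R M] [Module.Finite R F] [Module.Free R F] :
    Module.Projective R (Ext M F 0) :=
  have : Module.Projective R (M →ₗ[R] F) := Module.Projective.linearMap_of_finite
  Module.Projective.of_equiv
    ((Ext.linearEquiv₀ (R := R)).trans ModuleCat.homLinearEquiv : Ext M F 0 ≃ₗ[R] _).symm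

/-- If `M` has projective dimension at most `n`, `Ext^i(M, F) = 0` for `0 < i < n`, and
`Hom(M, F)` has finite projective dimension, then so does `Ext^n(M, F)`. -/
theorem ModuleCat.hasFiniteProjectiveDimension_ext [IsNoetherianRing R] (F : ModuleCat.{u} R)
    [Module.Finite R F] [Module.Free R F] (n : ℕ) (M : ModuleCat.{u} R) [Module.Finite R M]
    (hM : HasProjectiveDimensionLT M (n + 1))
    (hvanish : ∀ i, 0 < i → i < n → Subsingleton (Ext M F i))
    (hzero : HasFiniteProjectiveDimension R (Ext M F 0)) :
    HasFiniteProjectiveDimension R (Ext M F n) := by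
  induction n generalizing M with
  | zero => exact hzero
  | succ n ih =>
    obtain ⟨P, _, _, _, _, f, hf⟩ := Module.exists_finite_presentation R M
    let S : ShortComplex (ModuleCat.{u} R) := f.shortComplexKer
    have hS : S.ShortExact := LinearMap.shortExact_shortComplexKer hf
    have hP : Projective S.X₂ := inferInstanceAs (Projective (ModuleCat.of R P))
    have : Module.Finite R S.X₁ := inferInstanceAs (Module.Finite R (LinearMap.ker f))
    have : Module.Finite R S.X₂ := inferInstanceAs (Module.Finite R P)
    have : Module.Projective R S.X₂ := inferInstanceAs (Module.Projective R P)
    have hN : HasProjectiveDimensionLT S.X₁ (n + 1) :=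
      (hS.hasProjectiveDimensionLT_X₃_iff n hP).1 hM
    have hδ (i : ℕ) : Function.Surjective
        (Ext.precompOfLinear hS.extClass R F (add_comm 1 i)) := fun x ↦
      Ext.contravariant_sequence_exact₃ hS F x (Ext.eq_zero_of_projective _) (add_comm 1 i)
    have hg : Function.Injective (Ext.precompOfLinear (Ext.mk₀ S.g) R F (zero_add 0)) :=
      have := hS.epi_g
      Ext.precomp_mk₀_injective_of_epi F S.g
    have hgf : Function.Exact (Ext.precompOfLinear (Ext.mk₀ S.g) R F (zero_add 0))
        (Ext.precompOfLinear (Ext.mk₀ S.f) R F (zero_add 0)) :=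
      (ShortComplex.ab_exact_iff_function_exact _).1
        (Ext.contravariant_sequence_exact₂' hS F 0)
    have hfδ : Function.Exact (Ext.precompOfLinear (Ext.mk₀ S.f) R F (zero_add 0))
        (Ext.precompOfLinear hS.extClass R F (add_comm 1 0)) :=
      (ShortComplex.ab_exact_iff_function_exact _).1
        (Ext.contravariant_sequence_exact₁' hS F 0 1 rfl)
    have hP0 : HasFiniteProjectiveDimension R (Ext S.X₂ F 0) :=
      have := ModuleCat.projective_ext_zero S.X₂ F
      .of_projective
    rcases n with - | n
    -- Here the syzygy N = `S.X₁` is projective, and 0 → Hom(M,F) → Hom(P,F) → Hom(N,F) → Ext¹(M,F)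
    -- → 0 concludes.
    · have hN0 : HasFiniteProjectiveDimension R (Ext S.X₁ F 0) :=
        have : Projective S.X₁ := projective_iff_hasProjectiveDimensionLT_one.2 hN
        have : Module.Projective R S.X₁ := (IsProjective.iff_projective (R := R) S.X₁).2 this
        have := ModuleCat.projective_ext_zero S.X₁ F
        .of_projective
      exact .of_exact_of_exact hg hgf hfδ (hδ 0) hzero hP0 hN0
    -- Now Ext¹(M,F) = 0, so Hom(N,F) is Hom(P,F)/Hom(M,F). It is generally nonzero, which is why
    -- the induction carries finite projective dimension of Hom rather than its vanishing.
    · have : Subsingleton (Ext S.X₃ F 1) := hvanish 1 one_pos (by lia)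
      have hN0 : HasFiniteProjectiveDimension R (Ext S.X₁ F 0) :=
        .of_exact_right hgf hg (fun x ↦ (hfδ x).1 (Subsingleton.elim _ _)) hzero hP0
      have hinj (i : ℕ) : Function.Injective
          (Ext.precompOfLinear hS.extClass R F (add_comm 1 (i + 1))) := by
        rw [injective_iff_map_eq_zero]
        intro x hx
        obtain ⟨z, rfl⟩ := Ext.contravariant_sequence_exact₁ hS F x (add_comm 1 (i + 1)) hx
        rw [Ext.eq_zero_of_projective z, Ext.comp_zero]
      have e (i : ℕ) : Ext S.X₁ F (i + 1) ≃ₗ[R] Ext M F (i + 1 + 1) :=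
        LinearEquiv.ofBijective (Ext.precompOfLinear hS.extClass R F (add_comm 1 (i + 1)))
          ⟨hinj i, hδ (i + 1)⟩
      refine (ih S.X₁ hN (fun i hi hin ↦ ?_) hN0).of_linearEquiv (e n)
      obtain ⟨i, rfl⟩ := Nat.exists_eq_add_of_lt hi
      rw [zero_add]
      have := hvanish (0 + i + 1 + 1) (by lia) (by lia)
      rw [zero_add] at this
      exact (e i).toEquiv.subsingleton

theorem ModuleCat.ext_smul_eq_zero {N M : ModuleCat.{u} R} {r : R}
    (hr : r ∈ Module.annihilator R N) {n : ℕ} (x : Ext N M n) : r • x = 0 := by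
  have hid : r • 𝟙 N = 0 := by
    ext z
    exact Module.mem_annihilator.1 hr z
  rw [← Ext.mk₀_id_comp x, ← Ext.smul_comp, ← Ext.mk₀_smul, hid, Ext.mk₀_zero, Ext.zero_comp]

theorem ModuleCat.subsingleton_ext_of_free {N : ModuleCat.{u} R} {n : ℕ}
    (h : Subsingleton (Ext N (ModuleCat.of R R) n)) (F : ModuleCat.{u} R) [Module.Finite R F]
    [Module.Free R F] : Subsingleton (Ext N F n) := by
  let b := Module.Free.chooseBasis R F
  refine subsingleton_of_forall_eq 0 fun x ↦ ?_
  -- A basis writes the identity of F as a sum of maps factoring through R.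
  have hid : 𝟙 F = ∑ i, ModuleCat.ofHom (b.coord i) ≫
      ModuleCat.ofHom (LinearMap.toSpanSingleton R F (b i)) := by
    ext m
    simp [ModuleCat.hom_sum, b.sum_repr]
  rw [← Ext.comp_mk₀_id x, hid, Ext.mk₀_sum, Ext.comp_sum]
  refine Finset.sum_eq_zero fun i _ ↦ ?_
  rw [← Ext.mk₀_comp_mk₀, ← Ext.comp_assoc_of_third_deg_zero,
    Subsingleton.elim (x.comp (Ext.mk₀ (ModuleCat.ofHom (b.coord i))) (add_zero n)) 0,
    Ext.zero_comp]

/-- `Ext^i(R ⧸ I, F) = 0` for finite free `F` and `i` less than the grade of `I`. -/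
theorem Ideal.subsingleton_ext_of_lt_grade [IsNoetherianRing R] {I : Ideal R} (hI : I ≠ ⊤)
    {i : ℕ} (hi : (i : ℕ∞) < I.grade) (F : ModuleCat.{u} R) [Module.Finite R F]
    [Module.Free R F] : Subsingleton (Ext (ModuleCat.of R (R ⧸ I)) F i) := by
  simp only [Ideal.grade, lt_iSup_iff, Nat.cast_lt, exists_prop] at hi
  obtain ⟨rs, ⟨hmem, hreg⟩, hlt⟩ := hi
  refine ModuleCat.subsingleton_ext_of_free ?_ F
  have htop : I • (⊤ : Submodule R R) < ⊤ := by simpa [lt_top_iff_ne_top] using hI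
  refine ModuleCat.subsingleton_ext_of_exists_isRegular I _ ?_ (ModuleCat.of R R) htop rs hmem
    ((RingTheory.Sequence.isRegular_iff R rs).2 ⟨hreg, fun h ↦ htop.not_ge (h.le.trans ?_)⟩)
    i hlt
  · rw [Module.support_eq_zeroLocus, Ideal.annihilator_quotient]
  · have hle : Ideal.ofList rs ≤ I := Ideal.span_le.2 fun r hr ↦ hmem r hr
    exact Submodule.smul_mono_left hle

theorem Ideal.eq_zero_of_subsingleton_ext_zero {I : Ideal R} {N : Type u} [AddCommGroup N]
    [Module R N] (h : Subsingleton (Ext (ModuleCat.of R (R ⧸ I)) (ModuleCat.of R N) 0)) {z : N}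
    (hz : ∀ r ∈ I, r • z = 0) : z = 0 := by
  let φ : (R ⧸ I) →ₗ[R] N := I.liftQ (LinearMap.toSpanSingleton R N z) fun r hr ↦ hz r hr
  have hφ : φ = 0 := congrArg ModuleCat.Hom.hom
    ((Ext.mk₀_bijective _ _).1 (Subsingleton.elim (Ext.mk₀ (ModuleCat.ofHom φ)) (Ext.mk₀ 0)))
  have : φ (Ideal.Quotient.mk I 1) = z := one_smul R z
  rw [← this, hφ, LinearMap.zero_apply]

end Ext

/-! ### Finite free complexes with homology annihilated by I -/

section FreeComplex

variable {R : Type u} [CommRing R] {K : ℕ → Type u} [∀ p, AddCommGroup (K p)]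
  [∀ p, Module R (K p)]

/-- The map `K (p + 1) / im d → K p` induced by the differential of a complex. -/
def LinearMap.opcyclesMap (d : ∀ p, K (p + 1) →ₗ[R] K p) (hd : ∀ p, d p ∘ₗ d (p + 1) = 0) (p : ℕ) :
    (K (p + 1) ⧸ LinearMap.range (d (p + 1))) →ₗ[R] K p :=
  (LinearMap.range (d (p + 1))).liftQ (d p) (LinearMap.range_le_ker_iff.2 (hd p))

variable {d : ∀ p, K (p + 1) →ₗ[R] K p} {hd : ∀ p, d p ∘ₗ d (p + 1) = 0} {I : Ideal R} {l : ℕ}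

theorem LinearMap.exact_opcyclesMap_mkQ (p : ℕ) :
    Function.Exact (LinearMap.opcyclesMap d hd p) (LinearMap.range (d p)).mkQ := by
  rw [LinearMap.exact_iff, Submodule.ker_mkQ, LinearMap.opcyclesMap, Submodule.range_liftQ]

theorem LinearMap.smul_eq_zero_of_opcyclesMap_eq_zero
    (hI : ∀ p, ∀ r ∈ I, ∀ x, d p x = 0 → r • x ∈ LinearMap.range (d (p + 1))) {p : ℕ}
    {z : K (p + 1) ⧸ LinearMap.range (d (p + 1))} (hz : LinearMap.opcyclesMap d hd p z = 0)
    {r : R} (hr : r ∈ I) : r • z = 0 := by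
  obtain ⟨x, rfl⟩ := Submodule.mkQ_surjective _ z
  rw [← map_smul]
  exact (Submodule.Quotient.mk_eq_zero _).2 (hI p r hr x hz)

/-- The kernel is the homology in degree p + 1. It is killed by I, so each of its elements gives a
map from R/I, and Hom(R/I, –) of the source vanishes. -/
theorem LinearMap.opcyclesMap_injective
    (hI : ∀ p, ∀ r ∈ I, ∀ x, d p x = 0 → r • x ∈ LinearMap.range (d (p + 1))) {p : ℕ}
    (h : Subsingleton (Ext (ModuleCat.of R (R ⧸ I))
      (ModuleCat.of R (K (p + 1) ⧸ LinearMap.range (d (p + 1)))) 0)) :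
    Function.Injective (LinearMap.opcyclesMap d hd p) := by
  rw [injective_iff_map_eq_zero]
  exact fun z hz ↦ Ideal.eq_zero_of_subsingleton_ext_zero h fun r hr ↦
    LinearMap.smul_eq_zero_of_opcyclesMap_eq_zero hI hz hr

/-- The quotient of the top term of a complex by the zero boundaries. -/
noncomputable def LinearMap.quotRangeEquivOfSubsingleton {A B : Type u} [AddCommGroup A]
    [AddCommGroup B] [Module R A] [Module R B] [Subsingleton A] (f : A →ₗ[R] B) :
    B ≃ₗ[R] B ⧸ LinearMap.range f :=
  ((LinearMap.range f).quotEquivOfEqBot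
    (by rw [Subsingleton.elim f 0, LinearMap.range_zero])).symm


section

variable [∀ p, Module.Finite R (K p)] [∀ p, Module.Free R (K p)]

/-- If `I` annihilates the homology of a finite free complex of length `l`, then for `k` at most the
grade of `I` the cokernel of `K (l - k + 1) → K (l - k)` has finite projective dimension, and its
`Ext^i` from `R ⧸ I` vanishes as long as `i + k` is less than the grade of `I`. -/
theorem LinearMap.subsingleton_ext_quotient_range [IsNoetherianRing R]
    (hd : ∀ p, d p ∘ₗ d (p + 1) = 0) (hItop : I ≠ ⊤)
    (hI : ∀ p, ∀ r ∈ I, ∀ x, d p x = 0 → r • x ∈ LinearMap.range (d (p + 1)))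
    [Subsingleton (K (l + 1))] {g : ℕ} (hg : (g : ℕ∞) ≤ I.grade) (k p : ℕ) (hp : p + k = l)
    (hk : k ≤ g) :
    (∀ i, i + k < g → Subsingleton (Ext (ModuleCat.of R (R ⧸ I))
      (ModuleCat.of R (K p ⧸ LinearMap.range (d p))) i)) ∧
    HasFiniteProjectiveDimension R (K p ⧸ LinearMap.range (d p)) := by
  have hK (p i : ℕ) (hi : i < g) :
      Subsingleton (Ext (ModuleCat.of R (R ⧸ I)) (ModuleCat.of R (K p)) i) :=
    Ideal.subsingleton_ext_of_lt_grade hItop ((Nat.cast_lt.2 hi).trans_le hg)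
      (ModuleCat.of R (K p))
  induction k generalizing p with
  | zero =>
    obtain rfl : p = l := hp
    let e := LinearMap.quotRangeEquivOfSubsingleton (d p)
    refine ⟨fun i hi ↦ ?_, HasFiniteProjectiveDimension.of_projective.of_linearEquiv e⟩
    have := hK p i hi
    refine subsingleton_of_forall_eq 0 fun x ↦ ?_
    rw [← Ext.comp_mk₀_id x, ← e.toModuleIso.inv_hom_id, ← Ext.mk₀_comp_mk₀,
      ← Ext.comp_assoc_of_third_deg_zero,
      Subsingleton.elim (x.comp (Ext.mk₀ e.toModuleIso.inv) (add_zero i)) 0, Ext.zero_comp]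
  | succ k ih =>
    obtain ⟨hvan, hfin⟩ := ih (p + 1) (by lia) (by lia)
    have hinj := LinearMap.opcyclesMap_injective (hd := hd) hI (hvan 0 (by lia))
    have hex := LinearMap.exact_opcyclesMap_mkQ (d := d) (hd := hd) p
    refine ⟨fun i hi ↦ subsingleton_of_forall_eq 0 fun x ↦ ?_,
      .of_exact_right hex hinj (Submodule.mkQ_surjective _) hfin .of_projective⟩
    -- In 0 → C_{p+1} → K_p → C_p → 0, Ext^i of C_p lies between Ext^i of K_p and Ext^{i+1} of
    -- C_{p+1}, both zero.
    have := hvan (i + 1) (by lia)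
    have := hK p i (by lia)
    obtain ⟨y, rfl⟩ := Ext.covariant_sequence_exact₃ _
      (hex.shortExact_moduleCatShortComplex hinj (Submodule.mkQ_surjective _)) x rfl
      (Subsingleton.elim (α := Ext (ModuleCat.of R (R ⧸ I))
        (ModuleCat.of R (K (p + 1) ⧸ LinearMap.range (d (p + 1)))) (i + 1)) _ _)
    rw [Subsingleton.elim (α := Ext (ModuleCat.of R (R ⧸ I)) (ModuleCat.of R (K p)) i) y 0,
      Ext.zero_comp]

/-- Dimension shifting along the top part of a finite free complex of length `l` whose homology is
annihilated by `I` and whose differentials have entries in `I`. -/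
theorem LinearMap.hasFiniteProjectiveDimension_ext_quotient_range [IsNoetherianRing R]
    (hd : ∀ p, d p ∘ₗ d (p + 1) = 0) (hItop : I ≠ ⊤)
    (hI : ∀ p, ∀ r ∈ I, ∀ x, d p x = 0 → r • x ∈ LinearMap.range (d (p + 1)))
    (hdI : ∀ p, d p ∈ I • (⊤ : Submodule R (K (p + 1) →ₗ[R] K p)))
    [Subsingleton (K (l + 1))] {g : ℕ} (hg : (g : ℕ∞) ≤ I.grade)
    (hfin : ∀ p, HasFiniteProjectiveDimension R
      (Ext (ModuleCat.of R (R ⧸ I)) (ModuleCat.of R (K p)) g)) (k i p : ℕ) (hp : p + k = l)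
    (hk : i + k = g) :
    HasFiniteProjectiveDimension R (Ext (ModuleCat.of R (R ⧸ I))
      (ModuleCat.of R (K p ⧸ LinearMap.range (d p))) i) := by
  induction k generalizing p i with
  | zero =>
    obtain rfl : p = l := hp
    obtain rfl : i = g := hk
    let e := (LinearMap.quotRangeEquivOfSubsingleton (d p)).toModuleIso
    refine (hfin p).of_linearEquiv (LinearEquiv.ofLinearMap
      (Ext.postcompOfLinear (Ext.mk₀ e.hom) R _ (add_zero i))
      (Ext.postcompOfLinear (Ext.mk₀ e.inv) R _ (add_zero i)) ?_ ?_) <;>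
    · ext x
      simp
  | succ k ih =>
    have hK (i : ℕ) (hi : i < g) :
        Subsingleton (Ext (ModuleCat.of R (R ⧸ I)) (ModuleCat.of R (K p)) i) :=
      Ideal.subsingleton_ext_of_lt_grade hItop ((Nat.cast_lt.2 hi).trans_le hg)
        (ModuleCat.of R (K p))
    have hinj := LinearMap.opcyclesMap_injective (hd := hd) hI
      ((LinearMap.subsingleton_ext_quotient_range (l := l) hd hItop hI hg k (p + 1) (by lia)
        (by lia)).1 0 (by lia))
    have hS := (LinearMap.exact_opcyclesMap_mkQ (d := d) (hd := hd) p)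
      |>.shortExact_moduleCatShortComplex hinj (Submodule.mkQ_surjective _)
    refine (ih (i + 1) (p + 1) (by lia) (by lia)).of_linearEquiv
      (LinearEquiv.ofBijective (Ext.postcompOfLinear hS.extClass R _ rfl) ⟨?_, ?_⟩).symm
    · rw [injective_iff_map_eq_zero]
      intro x hx
      obtain ⟨y, rfl⟩ := Ext.covariant_sequence_exact₃ _ hS x rfl hx
      have := hK i (by lia)
      rw [Subsingleton.elim (α := Ext (ModuleCat.of R (R ⧸ I)) (ModuleCat.of R (K p)) i) y 0,
        Ext.zero_comp]
    · intro x
      refine Ext.covariant_sequence_exact₁ _ hS x ?_ rfl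
      -- Surjectivity of the connecting map needs Ext^{i+1}(R/I, C_{p+1}) → Ext^{i+1}(R/I, K_p) to
      -- be zero. The target vanishes unless i + 1 = g; then C_{p+1} = K_l, the map is induced by a
      -- matrix with entries in I, and I kills Ext from R/I.
      rcases k with - | k
      · obtain rfl : p + 1 = l := hp
        let e := (LinearMap.quotRangeEquivOfSubsingleton (d (p + 1))).toModuleIso
        have hcomp : e.hom ≫ ModuleCat.ofHom (LinearMap.opcyclesMap d hd p) =
            ModuleCat.ofHom (d p) := rfl
        have hzero (f : K (p + 1) →ₗ[R] K p)
            (hf : f ∈ I • (⊤ : Submodule R (K (p + 1) →ₗ[R] K p)))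
            (z : Ext (ModuleCat.of R (R ⧸ I)) (ModuleCat.of R (K (p + 1))) (i + 1)) :
            z.comp (Ext.mk₀ (ModuleCat.ofHom f)) (add_zero _) = 0 := by
          induction hf using Submodule.smul_induction_on' with
          | smul r hr f _ =>
            rw [show ModuleCat.ofHom (r • f) = r • ModuleCat.ofHom f from rfl, Ext.mk₀_smul,
              Ext.comp_smul]
            exact ModuleCat.ext_smul_eq_zero (by rwa [Ideal.annihilator_quotient]) _
          | add f _ f' _ hf hf' =>
            rw [ModuleCat.ofHom_add, Ext.mk₀_add, Ext.comp_add, hf, hf', add_zero]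
        have hx : x = (x.comp (Ext.mk₀ e.inv) (add_zero _)).comp (Ext.mk₀ e.hom) (add_zero _) := by
          simp
        rw [hx, Ext.comp_assoc_of_third_deg_zero, Ext.mk₀_comp_mk₀]
        exact (congrArg (fun f ↦ Ext.comp _ (Ext.mk₀ f) (add_zero (i + 1))) hcomp).trans
          (hzero _ (hdI p) _)
      · have := hK (i + 1) (by lia)
        exact Subsingleton.elim (α := Ext (ModuleCat.of R (R ⧸ I)) (ModuleCat.of R (K p)) (i + 1))
          _ _

end

/-- If `I` annihilates the homology of the complex in degree `p + 1` and `Hom(R ⧸ I, K p) = 0`, that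
homology module is `Hom(R ⧸ I, K (p + 1) / im d)`. -/
noncomputable def LinearMap.extZeroEquivKerOpcyclesMap
    (hI : ∀ p, ∀ r ∈ I, ∀ x, d p x = 0 → r • x ∈ LinearMap.range (d (p + 1))) (p : ℕ)
    (h : Subsingleton (Ext (ModuleCat.of R (R ⧸ I)) (ModuleCat.of R (K p)) 0)) :
    Ext (ModuleCat.of R (R ⧸ I))
      (ModuleCat.of R (K (p + 1) ⧸ LinearMap.range (d (p + 1)))) 0 ≃ₗ[R]
    LinearMap.ker (LinearMap.opcyclesMap d hd p) :=
  ((Ext.linearEquiv₀ (R := R)).trans ModuleCat.homLinearEquiv).trans <|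
    LinearEquiv.ofBijective
      (LinearMap.codRestrict _ (LinearMap.applyₗ (Ideal.Quotient.mk I 1)) fun φ ↦
        Ideal.eq_zero_of_subsingleton_ext_zero h fun r hr ↦ by
          rw [← map_smul, LinearMap.applyₗ_apply_apply, ← map_smul,
            show r • Ideal.Quotient.mk I 1 = 0 from
              Ideal.Quotient.eq_zero_iff_mem.2 (by simpa using hr), map_zero, map_zero])
      ⟨fun φ ψ hφψ ↦ Submodule.linearMap_qext _ (LinearMap.ext_ring (Subtype.ext_iff.1 hφψ)),
        fun z ↦ ⟨I.liftQ (LinearMap.toSpanSingleton R _ z) fun r hr ↦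
          LinearMap.smul_eq_zero_of_opcyclesMap_eq_zero hI z.2 hr,
          Subtype.ext (one_smul R (z : K (p + 1) ⧸ LinearMap.range (d (p + 1))))⟩⟩

end FreeComplex

theorem CategoryTheory.ShortComplex.hasFiniteProjectiveDimension_homology {R : Type u} [CommRing R]
    (S : ShortComplex (ModuleCat.{u} R))
    (hker : HasFiniteProjectiveDimension R (LinearMap.ker S.g.hom))
    (hrange : HasFiniteProjectiveDimension R (LinearMap.range S.f.hom)) :
    HasFiniteProjectiveDimension R S.homology := by
  have hle : LinearMap.ker S.moduleCatToCycles = LinearMap.ker S.f.hom :=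
    LinearMap.ker_codRestrict _ _ _
  have e : LinearMap.range S.f.hom ≃ₗ[R] LinearMap.range S.moduleCatToCycles :=
    S.f.hom.quotKerEquivRange.symm.trans <| (Submodule.quotEquivOfEq _ _ hle.symm).trans
      S.moduleCatToCycles.quotKerEquivRange
  exact ((hrange.of_linearEquiv e).quotient hker).of_linearEquiv
    S.moduleCatHomologyIso.symm.toLinearEquiv

/-! ### The Koszul complex on generators of I -/

namespace Koszul

variable {R : Type u} [CommRing R] {M : Type u} [AddCommGroup M] [Module R M]

/-- Exterior multiplication by m is a homotopy: d(m ∧ x) = φ(m) x − m ∧ dx. -/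
theorem smul_mem_range_differential (φ : Module.Dual R M) (m : M) (p : ℕ)
    {x : ⋀[R]^(p + 1) M} (hx : differential φ p x = 0) :
    φ m • x ∈ LinearMap.range (differential φ (p + 1)) := by
  have hmem : ExteriorAlgebra.ι R m * (x : ExteriorAlgebra R M) ∈ ⋀[R]^(p + 1 + 1) M := by
    rw [ExteriorAlgebra.exteriorPower, pow_succ']
    exact Submodule.mul_mem_mul ⟨m, rfl⟩ x.2
  refine ⟨⟨_, hmem⟩, Subtype.ext ?_⟩
  have hx' : CliffordAlgebra.contractLeft (Q := (0 : QuadraticForm R M)) φ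
      (x : ExteriorAlgebra R M) = 0 := congrArg Subtype.val hx
  refine (CliffordAlgebra.contractLeft_ι_mul (Q := (0 : QuadraticForm R M)) _ _ _).trans ?_
  rw [hx', mul_zero, sub_zero]
  rfl

/-- The Koszul differential, as a linear function of the linear form. -/
noncomputable def differentialₗ (R M : Type u) [CommRing R] [AddCommGroup M] [Module R M] (p : ℕ) :
    Module.Dual R M →ₗ[R] ⋀[R]^(p + 1) M →ₗ[R] ⋀[R]^p M where
  toFun φ := differential φ p
  map_add' φ ψ := LinearMap.ext fun _ ↦ Subtype.ext <| LinearMap.congr_fun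
    (map_add (CliffordAlgebra.contractLeft (Q := (0 : QuadraticForm R M))) φ ψ) _
  map_smul' r φ := LinearMap.ext fun _ ↦ Subtype.ext <| LinearMap.congr_fun
    (map_smul (CliffordAlgebra.contractLeft (Q := (0 : QuadraticForm R M))) r φ) _

variable {l : ℕ} (y : Fin l → R)

theorem differential_mem_span_smul_top (p : ℕ) :
    differential (Fintype.linearCombination R y) p ∈
      Ideal.span (Set.range y) •
        (⊤ : Submodule R (⋀[R]^(p + 1) (Fin l → R) →ₗ[R] ⋀[R]^p (Fin l → R))) := by
  have h : Fintype.linearCombination R y = ∑ i, y i • LinearMap.proj (R := R) i := by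
    ext i
    simp [Fintype.linearCombination_apply, Pi.single_apply]
  change differentialₗ R (Fin l → R) p _ ∈ _
  rw [h, map_sum]
  refine Submodule.sum_mem _ fun i _ ↦ ?_
  rw [map_smul]
  exact Submodule.smul_mem_smul (Ideal.subset_span ⟨i, rfl⟩) trivial

theorem exists_linearCombination_eq {r : R} (hr : r ∈ Ideal.span (Set.range y)) :
    ∃ c, Fintype.linearCombination R y c = r := by
  rwa [← Ideal.submodule_span_eq, ← Fintype.range_linearCombination] at hr

theorem subsingleton_exteriorPower {p : ℕ} (hp : l < p) :
    Subsingleton (⋀[R]^p (Fin l → R)) := by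
  have : IsEmpty (Set.powersetCard (Fin l) p) := by
    refine ⟨fun s ↦ ?_⟩
    have h := Finset.card_le_univ s.1
    rw [s.2, Fintype.card_fin] at h
    lia
  exact ((Pi.basisFun R (Fin l)).exteriorPower p).repr.toEquiv.subsingleton

theorem zeroEquiv_differential (φ : Module.Dual R M) (x : ⋀[R]^1 M) :
    exteriorPower.zeroEquiv R M (differential φ 0 x) = φ (exteriorPower.oneEquiv R M x) := by
  suffices (exteriorPower.zeroEquiv R M).toLinearMap ∘ₗ differential φ 0 =
      φ ∘ₗ (exteriorPower.oneEquiv R M).toLinearMap from LinearMap.congr_fun this x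
  refine exteriorPower.linearMap_ext (AlternatingMap.ext fun v ↦ ?_)
  have h : differential φ 0 (exteriorPower.ιMulti R 1 v) =
      φ (v 0) • exteriorPower.ιMulti R 0 (fun i ↦ v i.succ) := by
    refine Subtype.ext ?_
    change CliffordAlgebra.contractLeft (Q := (0 : QuadraticForm R M)) φ
      (ExteriorAlgebra.ιMulti R 1 v) = φ (v 0) • ExteriorAlgebra.ιMulti R 0 _
    rw [ExteriorAlgebra.ιMulti_succ_apply, ExteriorAlgebra.ιMulti_zero_apply,
      ExteriorAlgebra.ιMulti_zero_apply, mul_one]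
    exact (CliffordAlgebra.contractLeft_ι _ _ _).trans (Algebra.algebraMap_eq_smul_one _)
  simp [h]

/-- The cokernel of `K₁ → K₀` in the Koszul complex on generators of `I` is `R ⧸ I`. -/
noncomputable def quotRangeDifferentialZeroEquiv :
    (⋀[R]^0 (Fin l → R) ⧸ LinearMap.range (differential (Fintype.linearCombination R y) 0)) ≃ₗ[R]
      R ⧸ Ideal.span (Set.range y) :=
  Submodule.Quotient.equiv _ _ (exteriorPower.zeroEquiv R (Fin l → R)) <| by
    have h : (exteriorPower.zeroEquiv R (Fin l → R)).toLinearMap ∘ₗ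
        differential (Fintype.linearCombination R y) 0 =
        Fintype.linearCombination R y ∘ₗ (exteriorPower.oneEquiv R (Fin l → R)).toLinearMap :=
      LinearMap.ext (zeroEquiv_differential _)
    change Submodule.map (exteriorPower.zeroEquiv R (Fin l → R)).toLinearMap _ = _
    rw [← LinearMap.range_comp, h, LinearEquiv.range_comp, Fintype.range_linearCombination,
      Ideal.submodule_span_eq]

theorem hasFiniteProjectiveDimension_ker_differential_zero
    (h : HasFiniteProjectiveDimension R (R ⧸ Ideal.span (Set.range y))) :
    HasFiniteProjectiveDimension R
      (LinearMap.ker (differential (Fintype.linearCombination R y) 0)) :=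
  .ker_of_range .of_projective _
    (.of_quotient .of_projective (h.of_linearEquiv (quotRangeDifferentialZeroEquiv y).symm))

theorem hasFiniteProjectiveDimension_homology_one
    (hker : HasFiniteProjectiveDimension R
      (LinearMap.ker (differential (Fintype.linearCombination R y) 0)))
    (hrange : HasFiniteProjectiveDimension R
      (LinearMap.range (differential (Fintype.linearCombination R y) 1))) :
    HasFiniteProjectiveDimension R (homology y 1) := by
  have h1 : (complex y).d 2 1 =
      ModuleCat.ofHom (differential (Fintype.linearCombination R y) 1) :=
    ChainComplex.of_d (fun p ↦ ModuleCat.of R (⋀[R]^p (Fin l → R)))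
      (fun p ↦ ModuleCat.ofHom (differential (Fintype.linearCombination R y) p)) 1
  have h0 : (complex y).d 1 0 =
      ModuleCat.ofHom (differential (Fintype.linearCombination R y) 0) :=
    ChainComplex.of_d (fun p ↦ ModuleCat.of R (⋀[R]^p (Fin l → R)))
      (fun p ↦ ModuleCat.ofHom (differential (Fintype.linearCombination R y) p)) 0
  refine HasFiniteProjectiveDimension.of_linearEquiv
    (ShortComplex.hasFiniteProjectiveDimension_homology ((complex y).sc' 2 1 0) ?_ ?_)
    ((complex y).homologyIsoSc' 2 1 0 (by simp) (by simp)).symm.toLinearEquiv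
  · change HasFiniteProjectiveDimension R (LinearMap.ker ((complex y).d 1 0).hom)
    rw [h0]
    exact hker
  · change HasFiniteProjectiveDimension R (LinearMap.range ((complex y).d 2 1).hom)
    rw [h1]
    exact hrange

theorem hasFiniteProjectiveDimension_range_differential_one [IsNoetherianRing R] {g : ℕ}
    (hg : 0 < g) (hl : l = g + 2) (htop : Ideal.span (Set.range y) ≠ ⊤)
    (hgrade : (g : ℕ∞) ≤ (Ideal.span (Set.range y)).grade)
    (hpd : HasProjectiveDimensionLE (ModuleCat.of R (R ⧸ Ideal.span (Set.range y))) g) :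
    HasFiniteProjectiveDimension R
      (LinearMap.range (differential (Fintype.linearCombination R y) 1)) := by
  let φ := Fintype.linearCombination R y
  let I := Ideal.span (Set.range y)
  have hd (p : ℕ) : differential φ p ∘ₗ differential φ (p + 1) = 0 := differential_comp φ p
  have hI (p : ℕ) (r : R) (hr : r ∈ I) (x) (hx : differential φ p x = 0) :
      r • x ∈ LinearMap.range (differential φ (p + 1)) := by
    obtain ⟨c, rfl⟩ := exists_linearCombination_eq y hr
    exact smul_mem_range_differential φ c p hx
  have := subsingleton_exteriorPower (R := R) (Nat.lt_succ_self l)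
  have hvan (p i : ℕ) (hi : i < g) : Subsingleton (Ext (ModuleCat.of R (R ⧸ I))
      (ModuleCat.of R (⋀[R]^p (Fin l → R))) i) :=
    Ideal.subsingleton_ext_of_lt_grade htop ((Nat.cast_lt.2 hi).trans_le hgrade)
      (ModuleCat.of R (⋀[R]^p (Fin l → R)))
  have hfin (p : ℕ) : HasFiniteProjectiveDimension R (Ext (ModuleCat.of R (R ⧸ I))
      (ModuleCat.of R (⋀[R]^p (Fin l → R))) g) := by
    refine ModuleCat.hasFiniteProjectiveDimension_ext
      (ModuleCat.of R (⋀[R]^p (Fin l → R))) g (ModuleCat.of R (R ⧸ I)) hpd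
      (fun i _ hi ↦ hvan p i hi) ?_
    have := hvan p 0 hg
    exact .of_projective
  -- The equality l = g + 2 enters here: g shifts down from degree l end exactly in degree 2, at
  -- Hom(R/I, C_2).
  have hext := LinearMap.hasFiniteProjectiveDimension_ext_quotient_range
    (K := fun p ↦ ⋀[R]^p (Fin l → R)) (d := differential φ) (l := l) hd htop hI
    (differential_mem_span_smul_top y) hgrade hfin g 0 2 (by lia) (zero_add g)
  have hker := hext.of_linearEquiv
    (LinearMap.extZeroEquivKerOpcyclesMap
      (K := fun p ↦ ⋀[R]^p (Fin l → R)) (d := differential φ) (hd := hd) hI 1 (hvan 1 0 hg))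
  have hquot := (LinearMap.subsingleton_ext_quotient_range
    (K := fun p ↦ ⋀[R]^p (Fin l → R)) (d := differential φ) (l := l) hd htop hI hgrade g 2
    (by lia) le_rfl).2
  refine (hquot.range_of_ker _ hker).of_linearEquiv (LinearEquiv.ofEq _ _ ?_)
  rw [LinearMap.opcyclesMap, Submodule.range_liftQ]

end Koszul

/-- In grade 0, R/I would be projective, hence free and nonzero over the local ring, so its
annihilator I would be zero. -/
theorem Ideal.IsPerfect.grade_ne_zero {R : Type u} [CommRing R] [IsLocalRing R]
    {I : Ideal R} (hI : I.IsPerfect) (hbot : I ≠ ⊥) : I.grade ≠ 0 := by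
  intro h0
  have hpd := hI.2
  rw [h0] at hpd
  have hproj := ((projectiveDimension_eq_zero_iff _).1 hpd).1
  have : Module.Projective R (R ⧸ I) := (IsProjective.iff_projective (R := R) (R ⧸ I)).2 hproj
  have : Module.Free R (R ⧸ I) := Module.free_of_flat_of_isLocalRing
  have : Nontrivial (R ⧸ I) := Ideal.Quotient.nontrivial_iff.2 hI.1
  refine hbot ?_
  rw [← Ideal.annihilator_quotient (I := I), Module.annihilator_eq_bot]
  infer_instance

theorem theorem1p4 {R : Type u} [CommRing R] [IsLocalRing R] [IsNoetherianRing R] (I : Ideal R)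
    (hI : I.IsPerfect) (hν : (Submodule.spanFinrank I : ℕ∞) = I.grade + 2)
    (y : Fin (Submodule.spanFinrank I) → R) (hy : Ideal.span (Set.range y) = I) :
    projectiveDimension (Koszul.homology y 1) < ⊤ := by
  obtain ⟨g, hg⟩ : ∃ g : ℕ, I.grade = g := by
    refine ENat.ne_top_iff_exists.1 (fun h ↦ ?_) |>.imp fun _ ↦ Eq.symm
    rw [h, top_add] at hν
    exact ENat.natCast_ne_top _ hν
  have hl : Submodule.spanFinrank I = g + 2 := by
    rw [hg] at hν
    exact_mod_cast hν
  have hbot : I ≠ ⊥ := by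
    rintro rfl
    simp at hl
  have hg0 : 0 < g := by
    have := hI.grade_ne_zero hbot
    rw [hg] at this
    exact Nat.pos_of_ne_zero (by exact_mod_cast this)
  have hpd : HasProjectiveDimensionLE (ModuleCat.of R (R ⧸ I)) g := by
    rw [← projectiveDimension_le_iff, hI.2, hg]
    rfl
  -- The index type of `y` mentions I, so I can be replaced by the span only once this number is a
  -- free variable.
  generalize Submodule.spanFinrank I = l at y hl hν
  subst hy
  refine Module.HasFiniteProjectiveDimension.projectiveDimension_lt_top
    (Koszul.hasFiniteProjectiveDimension_homology_one y
      (Koszul.hasFiniteProjectiveDimension_ker_differential_zero y ⟨_, hpd⟩)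
      (Koszul.hasFiniteProjectiveDimension_range_differential_one y hg0 hl hI.1 hg.ge hpd))
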